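/- For integers $m\ge 0$, $N\ge m+1$ and real $\theta$ let $$\mathrm{Ls}_N^{(m)}(\theta)=-\int_0^\theta x^m\Big(\log\big|2\sin\tfrac x2\big|\Big)^{N-m-1}dx,\qquad \mathrm{Ls}_N(\theta)=\mathrm{Ls}_N^{(0)}(\theta),$$ let $\psi^{(n)}(x)=\frac{d^{n+1}}{dx^{n+1}}\log\Gamma(x)$ for $x>0$, and let $B_n$ be the complete Bell polynomials, $B_0=1$, $B_{n+1}(s_1,\dots,s_{n+1})=\sum_{i=0}^{n}\binom ni B_{n-i}(s_1,\dots,s_{n-i})\,s_{i+1}$. For $j,k\ge1$ put $$\bar\eta_j=(-1)^j(2^j-2)\psi^{(j-1)}(1),$$ $$\bar\xi_j=\bar\xi_j(k)=(-2)^j\psi^{(j-1)}(1)+2\,[j\text{ odd}]\,\psi^{(j-1)}(k)-2\,[j\text{ even}]\,\psi^{(j-1)}(1)+\frac{(j-1)!}{k^j},$$ where $[\cdot]$ is $1$ if the condition holds and $0$ otherwise. Equivalently (this is part of the claim) $\bar\xi_j=\bar\eta_j+2\,[j\text{ odd}]\,(\psi^{(j-1)}(k)-\psi^{(j-1)}(1))+\frac{(j-1)!}{k^j}$.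 Then, for all integers $p\ge0$ (all the integrals involved exist): (a) If $z=2\pi$ and $n\in\{0,1\}$, or $z=\pi$ and $n=0$, then $$\mathrm{Ls}^{(n)}_{p+n+1}(z)=\frac{(-1)^{p+1}z^{n+1}}{2^p(n+1)}\,B_p(0,\bar\eta_2,\bar\eta_3,\dots,\bar\eta_p).$$ (b) For every real $z$, $$\mathrm{Ls}_{p+1}(z)=\frac{(-1)^{p+1}}{2^p}\Big(z\,B_p(0,\bar\eta_2,\dots,\bar\eta_p)+2p\sum_{k=1}^\infty\frac{\sin(kz)}{k^2}\,B_{p-1}\big(\bar\xi_1(k),\dots,\bar\xi_{p-1}(k)\big)\Big),$$ where the series converges absolutely; for $p=0$ the second term, which carries the factor $p$, is absent. -/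

import Mathlib

open scoped Real Nat

noncomputable section

/-- The generalized log-sine integral `Ls_N^{(m)}(θ)`, for `N ≥ m + 1`. -/
def genLogSine (N m : ℕ) (θ : ℝ) : ℝ :=
  -∫ x in (0 : ℝ)..θ, x ^ m * Real.log |2 * Real.sin (x / 2)| ^ (N - m - 1)

/-- The log-sine integral `Ls_N(θ)`, for `N ≥ 1`. -/
def logSine (N : ℕ) (θ : ℝ) : ℝ :=
  -∫ x in (0 : ℝ)..θ, Real.log |2 * Real.sin (x / 2)| ^ (N - 1)

/-- The polygamma function `ψ^{(n)}(x) = d^{n+1}/dx^{n+1} log Γ(x)`, for `x > 0`. -/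
def polygamma (n : ℕ) (x : ℝ) : ℝ :=
  iteratedDeriv (n + 1) (fun t : ℝ => Real.log (Real.Gamma t)) x

/-- The complete Bell polynomial `B_n(s 1, …, s n)`, given by `B_0 = 1` and
`B_{n+1} = ∑_{i=0}^{n} (n choose i) B_{n-i} s_{i+1}`. The value `s 0` is never used. -/
def completeBell (s : ℕ → ℝ) : ℕ → ℝ
  | 0 => 1
  | n + 1 => ∑ i : Fin (n + 1), (n.choose i : ℝ) * completeBell s (n - i) * s (i + 1)

/-- `η̄_j = (-1)^j (2^j - 2) ψ^{(j-1)}(1)`, for `j ≥ 1`. -/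
def etaBar (j : ℕ) : ℝ := (-1) ^ j * (2 ^ j - 2) * polygamma (j - 1) 1

/-- `ξ̄_j`, for `j ≥ 1`, which depends on an index `k ≥ 1`. -/
def xiBar (k j : ℕ) : ℝ :=
  (-2) ^ j * polygamma (j - 1) 1
    + (if Odd j then 2 * polygamma (j - 1) (k : ℝ) else 0)
    - (if Even j then 2 * polygamma (j - 1) 1 else 0)
    + ((j - 1)! : ℝ) / (k : ℝ) ^ j

end

noncomputable section

open Filter Topology MeasureTheory Set ProbabilityTheory

/-! Put c_k(u) = ∫_0^{2π} (2 sin(x/2))^{-2u} cos(kx) dx. Its p-th derivative at u = 0 is (-2)^p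
times the k-th cosine moment of log^p|2 sin(x/2)|. A beta integral evaluates c_0
(`integral_sin_half_rpow`), and a two-term recursion in k (`cosCoeff_succ`) then gives every c_k as
a quotient of Gamma values: c_0 = 2π exp(`logMean`) and c_k = 2πu exp(`logCoeff k`) for k ≥ 1.
Derivatives of exp ∘ L are Bell polynomials in the derivatives of L (`iteratedDeriv_exp_comp`), here
polygamma values; the extra factor u produces the factor p and the index p - 1.

The sine series is the Fourier series of log^p|2 sin(x/2)| integrated termwise. This is legitimate
because the primitive of its mean-zero part is continuous and periodic with absolutely summable
Fourier coefficients (`hasSum_sin_of_mean_zero`). The special values come from the c_0 moment and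
the reflection x ↦ 2π - x. -/

/-! ### Bell polynomials and iterated derivatives -/

theorem completeBell_congr {s s' : ℕ → ℝ} (h : ∀ j, 1 ≤ j → s j = s' j) (n : ℕ) :
    completeBell s n = completeBell s' n := by
  induction n using Nat.strong_induction_on with
  | _ n ih =>
    cases n with
    | zero => simp [completeBell]
    | succ n =>
      rw [completeBell, completeBell]
      refine Finset.sum_congr rfl fun i _ => ?_
      rw [ih (n - i) (by omega), h (i + 1) (by omega)]

theorem analyticAt_exp_comp {L : ℝ → ℝ} {x : ℝ} (hL : AnalyticAt ℝ L x) :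
    AnalyticAt ℝ (fun u => Real.exp (L u)) x := hL.rexp

/-- Derivatives of `exp ∘ L` are given by the complete Bell polynomials. -/
theorem iteratedDeriv_exp_comp {L : ℝ → ℝ} {x : ℝ} (hL : AnalyticAt ℝ L x) (n : ℕ) :
    iteratedDeriv n (fun u => Real.exp (L u)) x =
      Real.exp (L x) * completeBell (fun j => iteratedDeriv j L x) n := by
  induction n using Nat.strong_induction_on with
  | _ n ih =>
    cases n with
    | zero => simp [completeBell]
    | succ n =>
      -- The Leibniz rule applied to L' · exp L is exactly the recursion defining `completeBell`.
      have hd : deriv (fun u => Real.exp (L u)) =ᶠ[𝓝 x] deriv L * fun u => Real.exp (L u) := by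
        filter_upwards [hL.eventually_analyticAt] with y hy
        rw [_root_.deriv_exp hy.differentiableAt, Pi.mul_apply, mul_comm]
      rw [iteratedDeriv_succ', hd.iteratedDeriv_eq,
        iteratedDeriv_mul hL.deriv.contDiffAt (analyticAt_exp_comp hL).contDiffAt, completeBell,
        Finset.sum_range, Finset.mul_sum]
      refine Finset.sum_congr rfl fun i _ => ?_
      rw [ih (n - i) (by omega), ← iteratedDeriv_succ']
      ring

/-- In the Leibniz sum only the first derivative of u is nonzero at 0. -/
theorem iteratedDeriv_succ_id_mul {F : ℝ → ℝ} (hF : AnalyticAt ℝ F 0) (n : ℕ) :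
    iteratedDeriv (n + 1) (fun u => u * F u) 0 = (n + 1 : ℝ) * iteratedDeriv n F 0 := by
  have := iteratedDeriv_mul (n := n + 1) (f := fun u : ℝ => u) (g := F) (x := 0)
    contDiffAt_id hF.contDiffAt
  change iteratedDeriv (n + 1) ((fun u => u) * F) 0 = _
  rw [this, Finset.sum_eq_single 1]
  · simp [iteratedDeriv_fun_id_zero]
  · intro i _ hi
    rw [iteratedDeriv_fun_id_zero]
    simp [hi]
  · simp

theorem iteratedDeriv_comp_affine (g : ℝ → ℝ) (a c : ℝ) (n : ℕ) :
    iteratedDeriv n (fun u => g (a + c * u)) = fun u => c ^ n * iteratedDeriv n g (a + c * u) := by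
  induction n with
  | zero => simp
  | succ n ih =>
    rw [iteratedDeriv_succ, ih]
    ext u
    rw [deriv_const_mul_field, deriv_comp_mul_left c (fun y => iteratedDeriv n g (a + y)) u,
      deriv_comp_const_add, iteratedDeriv_succ, smul_eq_mul]
    ring

theorem iteratedDeriv_succ_real_log (n : ℕ) (x : ℝ) :
    iteratedDeriv (n + 1) Real.log x = (-1) ^ n * n ! / x ^ (n + 1) := by
  rw [iteratedDeriv_succ', Real.deriv_log', iteratedDeriv_eq_iterate]
  have := congrFun (iter_deriv_inv' (𝕜 := ℝ) n) x
  change deriv^[n] Inv.inv x = _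
  rw [this, div_eq_mul_inv, ← zpow_natCast x, ← zpow_neg]
  congr 2
  push_cast
  ring

/-! ### Logarithms of the Gamma quotients and their Taylor coefficients -/

theorem Real.analyticAt_Gamma {x : ℝ} (hx : 0 < x) : AnalyticAt ℝ Real.Gamma x := by
  have h : AnalyticAt ℂ Complex.Gamma x := by
    refine DifferentiableOn.analyticAt (s := {z : ℂ | 0 < z.re}) (fun z hz => ?_) ?_
    · refine (Complex.differentiableAt_Gamma z fun m hm => ?_).differentiableWithinAt
      have : z.re = -(m : ℝ) := by rw [hm]; simp
      have h0 : 0 < z.re := hz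
      have : (0 : ℝ) ≤ m := m.cast_nonneg
      linarith
    · exact (isOpen_lt continuous_const Complex.continuous_re).mem_nhds (by simpa using hx)
  exact h.re_ofReal.congr (Eventually.of_forall fun y => by simp [Complex.Gamma_ofReal])

theorem analyticAt_log_Gamma {x : ℝ} (hx : 0 < x) :
    AnalyticAt ℝ (fun t => Real.log (Real.Gamma t)) x :=
  (Real.analyticAt_Gamma hx).log (Real.Gamma_pos_of_pos hx)

/-- The logarithm of `Γ(1 - 2u) / Γ(1 - u)²`. -/
def logMean (u : ℝ) : ℝ :=
  Real.log (Real.Gamma (1 - 2 * u)) - 2 * Real.log (Real.Gamma (1 - u))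

/-- The logarithm of `Γ(1 - 2u) Γ(k + u) / (Γ(1 + u) Γ(1 - u) Γ(k + 1 - u))`. -/
def logCoeff (k : ℕ) (u : ℝ) : ℝ :=
  Real.log (Real.Gamma (1 - 2 * u)) + Real.log (Real.Gamma (k + u))
    - Real.log (Real.Gamma (k - u)) - Real.log (Real.Gamma (1 + u))
    - Real.log (Real.Gamma (1 - u)) - Real.log (k - u)

theorem analyticAt_comp_affine {g : ℝ → ℝ} {a : ℝ} (hg : AnalyticAt ℝ g a) (c : ℝ) :
    AnalyticAt ℝ (fun u => g (a + c * u)) 0 :=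
  AnalyticAt.fun_comp (f := fun u => a + c * u) (by simpa using hg)
    (analyticAt_const.add (analyticAt_const.mul analyticAt_id))

theorem logMean_eq : logMean = (fun u => Real.log (Real.Gamma (1 + (-2) * u)))
    - 2 * (fun u => Real.log (Real.Gamma (1 + (-1) * u))) := by
  ext u
  simp only [logMean, Pi.sub_apply, Pi.mul_apply, Pi.ofNat_apply]
  ring_nf

theorem logCoeff_eq (k : ℕ) : logCoeff k = (fun u => Real.log (Real.Gamma (1 + (-2) * u)))
    + (fun u => Real.log (Real.Gamma (k + 1 * u)))
    - (fun u => Real.log (Real.Gamma (k + (-1) * u)))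
    - (fun u => Real.log (Real.Gamma (1 + 1 * u)))
    - (fun u => Real.log (Real.Gamma (1 + (-1) * u)))
    - (fun u => Real.log (k + (-1) * u)) := by
  ext u
  simp only [logCoeff, Pi.sub_apply, Pi.add_apply]
  ring_nf

theorem analyticAt_logMean : AnalyticAt ℝ logMean 0 := by
  rw [logMean_eq]
  exact (analyticAt_comp_affine (analyticAt_log_Gamma one_pos) _).sub
    (analyticAt_const.mul (analyticAt_comp_affine (analyticAt_log_Gamma one_pos) _))

theorem analyticAt_logCoeff {k : ℕ} (hk : 1 ≤ k) : AnalyticAt ℝ (logCoeff k) 0 := by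
  have hk' : (0 : ℝ) < k := by exact_mod_cast hk
  have h1 := fun c => analyticAt_comp_affine (analyticAt_log_Gamma one_pos) c
  have h2 := fun c => analyticAt_comp_affine (analyticAt_log_Gamma hk') c
  rw [logCoeff_eq]
  exact (((((h1 _).add (h2 _)).sub (h2 _)).sub (h1 _)).sub (h1 _)).sub
    (analyticAt_comp_affine (analyticAt_log hk') _)

theorem iteratedDeriv_logMean (j : ℕ) (hj : 1 ≤ j) : iteratedDeriv j logMean 0 = etaBar j := by
  obtain ⟨j, rfl⟩ := Nat.exists_eq_add_of_le' hj
  have h1 := fun c => analyticAt_comp_affine (analyticAt_log_Gamma one_pos) c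
  have h2 : (2 * fun u : ℝ => Real.log (Real.Gamma (1 + (-1) * u))) =
    fun u => 2 * Real.log (Real.Gamma (1 + (-1) * u)) := rfl
  have h3 : AnalyticAt ℝ (2 * fun u : ℝ => Real.log (Real.Gamma (1 + (-1) * u))) 0 :=
    analyticAt_const.mul (h1 _)
  rw [logMean_eq, iteratedDeriv_sub (h1 _).contDiffAt h3.contDiffAt,
    h2, iteratedDeriv_const_mul_field]
  have h := fun a c => iteratedDeriv_comp_affine (fun t => Real.log (Real.Gamma t)) a c (j + 1)
  simp only [h, etaBar, polygamma]
  simp only [mul_zero, add_zero, Nat.add_sub_cancel]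
  rw [neg_pow 2]
  ring

/-- By parity in u, the pair log Γ(k ± u) contributes only for odd j and the pair log Γ(1 ± u) only
for even j. The term -log(k - u), split off from Γ(k + 1 - u), gives (j-1)!/k^j. -/
theorem iteratedDeriv_logCoeff {k : ℕ} (hk : 1 ≤ k) (j : ℕ) (hj : 1 ≤ j) :
    iteratedDeriv j (logCoeff k) 0 = xiBar k j := by
  obtain ⟨j, rfl⟩ := Nat.exists_eq_add_of_le' hj
  have hk' : (0 : ℝ) < k := by exact_mod_cast hk
  have h1 := fun c => analyticAt_comp_affine (analyticAt_log_Gamma one_pos) c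
  have h2 := fun c => analyticAt_comp_affine (analyticAt_log_Gamma hk') c
  have h3 := fun c => analyticAt_comp_affine (analyticAt_log hk') c
  rw [logCoeff_eq,
    iteratedDeriv_sub (((((h1 _).add (h2 _)).sub (h2 _)).sub (h1 _)).sub (h1 _)).contDiffAt
      (h3 _).contDiffAt,
    iteratedDeriv_sub ((((h1 _).add (h2 _)).sub (h2 _)).sub (h1 _)).contDiffAt (h1 _).contDiffAt,
    iteratedDeriv_sub (((h1 _).add (h2 _)).sub (h2 _)).contDiffAt (h1 _).contDiffAt,
    iteratedDeriv_sub ((h1 _).add (h2 _)).contDiffAt (h2 _).contDiffAt,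
    iteratedDeriv_add (h1 _).contDiffAt (h2 _).contDiffAt]
  have h := fun a c => iteratedDeriv_comp_affine (fun t => Real.log (Real.Gamma t)) a c (j + 1)
  simp only [h, iteratedDeriv_comp_affine Real.log, xiBar, polygamma]
  simp only [mul_zero, add_zero, Nat.add_sub_cancel, iteratedDeriv_succ_real_log, one_pow, one_mul]
  rcases Nat.even_or_odd (j + 1) with hp | hp
  · have h4 : (-1 : ℝ) ^ j = -1 := (by simpa [parity_simps] using hp : Odd j).neg_one_pow
    rw [hp.neg_one_pow, h4, if_pos hp, if_neg (Nat.not_odd_iff_even.2 hp)]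
    ring
  · have h4 : (-1 : ℝ) ^ j = 1 := (by simpa [parity_simps] using hp : Even j).neg_one_pow
    rw [hp.neg_one_pow, h4, if_pos hp, if_neg (Nat.not_even_iff_odd.2 hp)]
    ring

theorem etaBar_one : etaBar 1 = 0 := by simp [etaBar]

theorem iteratedDeriv_exp_logMean (n : ℕ) :
    iteratedDeriv n (fun u => Real.exp (logMean u)) 0 = completeBell (Function.update etaBar 1 0) n := by
  have h : Function.update etaBar 1 0 = etaBar := by
    conv_lhs => rw [← etaBar_one, Function.update_eq_self]
  rw [h, iteratedDeriv_exp_comp analyticAt_logMean,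
    completeBell_congr iteratedDeriv_logMean]
  simp [logMean]

theorem iteratedDeriv_mul_exp_logCoeff {k : ℕ} (hk : 1 ≤ k) (n : ℕ) :
    iteratedDeriv (n + 1) (fun u => u * Real.exp (logCoeff k u)) 0 =
      (n + 1) / k * completeBell (xiBar k) n := by
  have hk' : (0 : ℝ) < k := by exact_mod_cast hk
  rw [iteratedDeriv_succ_id_mul (analyticAt_exp_comp (analyticAt_logCoeff hk)),
    iteratedDeriv_exp_comp (analyticAt_logCoeff hk),
    completeBell_congr (iteratedDeriv_logCoeff hk)]
  -- At u = 0 the Gamma factors cancel, leaving exp(-log k) = 1/k.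
  simp [logCoeff, Real.exp_neg, Real.exp_log hk']
  ring

theorem xiBar_eq_etaBar_add (k j : ℕ) :
    xiBar k j = etaBar j
      + (if Odd j then 2 * (polygamma (j - 1) (k : ℝ) - polygamma (j - 1) 1) else 0)
      + ((j - 1)! : ℝ) / (k : ℝ) ^ j := by
  rw [xiBar, etaBar, neg_pow 2]
  rcases Nat.even_or_odd j with hp | hp
  · rw [hp.neg_one_pow, if_pos hp, if_neg (Nat.not_odd_iff_even.2 hp),
      if_neg (Nat.not_odd_iff_even.2 hp)]
    ring
  · rw [hp.neg_one_pow, if_pos hp, if_pos hp, if_neg (Nat.not_even_iff_odd.2 hp)]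
    ring

/-! ### The mean of (2 sin(x/2))^t as a beta integral -/

theorem intervalIntegrable_beta {α β : ℝ} (hα : 0 < α) (hβ : 0 < β) :
    IntervalIntegrable (fun s : ℝ => s ^ (α - 1) * (1 - s) ^ (β - 1)) volume 0 1 ∧
      ∫ s in (0 : ℝ)..1, s ^ (α - 1) * (1 - s) ^ (β - 1) =
        Real.Gamma α * Real.Gamma β / Real.Gamma (α + β) := by
  have hcast : ∀ s ∈ uIoc (0 : ℝ) 1, (s : ℂ) ^ ((α : ℂ) - 1) * (1 - (s : ℂ)) ^ ((β : ℂ) - 1) =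
      ((s ^ (α - 1) * (1 - s) ^ (β - 1) : ℝ) : ℂ) := by
    intro s hs
    rw [uIoc_of_le zero_le_one] at hs
    rw [Complex.ofReal_mul, Complex.ofReal_cpow hs.1.le, Complex.ofReal_cpow (by linarith [hs.2])]
    push_cast
    rfl
  have hc := Complex.betaIntegral_convergent (u := α) (v := β) (by simpa) (by simpa)
  have he := Complex.betaIntegral_eq_Gamma_mul_div α β (by simpa) (by simpa)
  rw [Complex.betaIntegral, intervalIntegral.integral_congr_ae (ae_of_all _ hcast),
    intervalIntegral.integral_ofReal] at he
  have hi := (intervalIntegrable_congr hcast).1 hc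
  refine ⟨?_, ?_⟩
  · rw [intervalIntegrable_iff] at hi ⊢
    simpa [IntegrableOn] using hi.re
  · rw [← Complex.ofReal_add, Complex.Gamma_ofReal, Complex.Gamma_ofReal, Complex.Gamma_ofReal]
      at he
    exact_mod_cast he

theorem sin_half_pos {x : ℝ} (hx : x ∈ Ioo 0 (2 * π)) : 0 < Real.sin (x / 2) :=
  Real.sin_pos_of_pos_of_lt_pi (by linarith [hx.1]) (by linarith [hx.2])

/-- The substitution `s = (1 - cos (x / 2)) / 2` turns the integrand into that of a beta
integral. -/
theorem two_mul_sin_half_rpow_eq (t : ℝ) {x : ℝ} (hx : x ∈ Ioo 0 (2 * π)) :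
    (2 * Real.sin (x / 2)) ^ t = 2 * 4 ^ t *
      (((fun s : ℝ => s ^ ((t + 1) / 2 - 1) * (1 - s) ^ ((t + 1) / 2 - 1)) ∘
        fun x => (1 - Real.cos (x / 2)) / 2) x * (Real.sin (x / 2) / 4)) := by
  have hs := sin_half_pos hx
  have h0 : 0 ≤ (1 - Real.cos (x / 2)) / 2 := by linarith [Real.cos_le_one (x / 2)]
  have h1 : 0 ≤ 1 - (1 - Real.cos (x / 2)) / 2 := by linarith [Real.neg_one_le_cos (x / 2)]
  -- With s the substituted variable, s(1 - s) = (sin(x/2)/2)², so equal beta exponents give a pure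
  -- power of the sine.
  have h2 : (1 - Real.cos (x / 2)) / 2 * (1 - (1 - Real.cos (x / 2)) / 2) =
      (Real.sin (x / 2) / 2) ^ (2 : ℝ) := by
    rw [Real.rpow_two]
    linarith [Real.sin_sq_add_cos_sq (x / 2)]
  simp only [Function.comp_apply]
  rw [← Real.mul_rpow h0 h1, h2, ← Real.rpow_mul (by positivity),
    show 2 * Real.sin (x / 2) = 4 * (Real.sin (x / 2) / 2) by ring,
    Real.mul_rpow (by norm_num) (by positivity),
    show (2 : ℝ) * ((t + 1) / 2 - 1) = t - 1 by ring, Real.rpow_sub_one (by positivity)]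
  field_simp
  norm_num

theorem sin_half_rpow_aux {t : ℝ} (ht : -1 < t) :
    IntervalIntegrable (fun x : ℝ => (2 * Real.sin (x / 2)) ^ t) volume 0 (2 * π) ∧
      ∫ x in (0 : ℝ)..2 * π, (2 * Real.sin (x / 2)) ^ t =
        2 * π * (Real.Gamma (1 + t) / Real.Gamma (1 + t / 2) ^ 2) := by
  have hπ := Real.pi_pos
  have hα : 0 < (t + 1) / 2 := by linarith
  obtain ⟨hi, he⟩ := intervalIntegrable_beta hα hα
  set g : ℝ → ℝ := fun s : ℝ => s ^ ((t + 1) / 2 - 1) * (1 - s) ^ ((t + 1) / 2 - 1) with hg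
  set f : ℝ → ℝ := fun x => (1 - Real.cos (x / 2)) / 2 with hf
  have hfc : ContinuousOn f (uIcc 0 (2 * π)) := by fun_prop
  have hfd : ∀ x ∈ Ioo (min 0 (2 * π)) (max 0 (2 * π)),
      HasDerivAt f (Real.sin (x / 2) / 4) x := by
    intro x _
    have := ((((hasDerivAt_id x).div_const 2).cos).const_sub 1).div_const 2
    refine this.congr_deriv ?_
    simp only [id]
    ring
  have hf0 : ∀ x ∈ Ioo (min 0 (2 * π)) (max 0 (2 * π)), 0 ≤ Real.sin (x / 2) / 4 := by
    intro x hx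
    rw [min_eq_left (by positivity), max_eq_right (by positivity)] at hx
    linarith [sin_half_pos hx]
  have e0 : f 0 = 0 := by simp [hf]
  have e1 : f (2 * π) = 1 := by simp [hf]
  have hcongr : ∀ x ∈ Ioo 0 (2 * π), (2 * Real.sin (x / 2)) ^ t =
      2 * 4 ^ t * ((g ∘ f) x * (Real.sin (x / 2) / 4)) := fun x hx =>
    two_mul_sin_half_rpow_eq t hx
  refine ⟨?_, ?_⟩
  · have := (intervalIntegral.integrable_comp_mul_deriv_iff_of_deriv_nonneg
      hfc hfd hf0 (g := g)).2 (by rwa [e0, e1])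
    have := this.const_mul (2 * 4 ^ t)
    rw [intervalIntegrable_iff_integrableOn_Ioo_of_le (by positivity)] at this ⊢
    exact this.congr_fun (fun x hx => (hcongr x hx).symm) measurableSet_Ioo
  · rw [intervalIntegral.integral_congr_Ioo_of_le (by positivity) hcongr,
      intervalIntegral.integral_const_mul,
      intervalIntegral.integral_comp_mul_deriv_of_deriv_nonneg hfc hfd hf0, e0, e1, he]
    -- Legendre duplication turns Γ((t+1)/2)²/Γ(1+t) into Γ(1+t)/Γ(1+t/2)², up to the factor π/4^t.
    have hd := Real.Gamma_mul_Gamma_add_half ((t + 1) / 2)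
    have h1 := Real.Gamma_pos_of_pos hα
    have h2 : 0 < Real.Gamma (1 + t / 2) := Real.Gamma_pos_of_pos (by linarith)
    have h3 : 0 < Real.Gamma (1 + t) := Real.Gamma_pos_of_pos (by linarith)
    rw [show (t + 1) / 2 + 1 / 2 = 1 + t / 2 by ring, show 2 * ((t + 1) / 2) = 1 + t by ring,
      show 1 - (1 + t) = -t by ring, Real.rpow_neg (by norm_num)] at hd
    rw [show (t + 1) / 2 + (t + 1) / 2 = 1 + t by ring]
    have h4 : (4 : ℝ) ^ t = 2 ^ t * 2 ^ t := by
      rw [← Real.mul_rpow (by norm_num) (by norm_num)]; norm_num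
    have h5 : (0 : ℝ) < 2 ^ t := by positivity
    have h6 : Real.Gamma ((t + 1) / 2) =
        Real.Gamma (1 + t) * ((2 : ℝ) ^ t)⁻¹ * √π / Real.Gamma (1 + t / 2) := by
      rw [eq_div_iff h2.ne', hd]
    rw [h6, h4]
    field_simp
    rw [Real.sq_sqrt hπ.le]

theorem intervalIntegrable_sin_half_rpow {t : ℝ} (ht : -1 < t) :
    IntervalIntegrable (fun x : ℝ => (2 * Real.sin (x / 2)) ^ t) volume 0 (2 * π) :=
  (sin_half_rpow_aux ht).1

theorem integral_sin_half_rpow {t : ℝ} (ht : -1 < t) :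
    ∫ x in (0 : ℝ)..2 * π, (2 * Real.sin (x / 2)) ^ t =
      2 * π * (Real.Gamma (1 + t) / Real.Gamma (1 + t / 2) ^ 2) :=
  (sin_half_rpow_aux ht).2

/-! ### Closed form of the cosine coefficients -/

/-- The cosine coefficients of `(2 sin (x / 2)) ^ t` on `[0, 2π]`, up to normalization. -/
def cosCoeff (k : ℕ) (t : ℝ) : ℝ :=
  ∫ x in (0 : ℝ)..2 * π, (2 * Real.sin (x / 2)) ^ t * Real.cos (k * x)

theorem cosCoeff_integrable (k : ℕ) {t : ℝ} (ht : -1 < t) :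
    IntervalIntegrable (fun x => (2 * Real.sin (x / 2)) ^ t * Real.cos (k * x)) volume
      0 (2 * π) :=
  (intervalIntegrable_sin_half_rpow ht).mul_continuousOn (by fun_prop)

/-- (2 sin(x/2))^{t+1} cos((k+1/2)x) vanishes at 0 and 2π because t + 1 > 0, and its derivative
combines the integrands of the two neighbouring coefficients. -/
theorem cosCoeff_succ (k : ℕ) {t : ℝ} (ht : -1 < t) :
    (k + 1 + t / 2) * cosCoeff (k + 1) t = (k - t / 2) * cosCoeff k t := by
  have hπ := Real.pi_pos
  have h0 := cosCoeff_integrable k ht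
  have h1 := cosCoeff_integrable (k + 1) ht
  set F : ℝ → ℝ := fun x => (2 * Real.sin (x / 2)) ^ (t + 1) * Real.cos ((k + 1 / 2) * x) with hF
  have hFc : ContinuousOn F (Icc 0 (2 * π)) := by
    refine ContinuousOn.mul (ContinuousOn.rpow_const (by fun_prop) fun x _ => Or.inr ?_)
      (by fun_prop)
    linarith
  have hFd : ∀ x ∈ Ioo 0 (2 * π), HasDerivAt F
      ((k + 1 + t / 2) * ((2 * Real.sin (x / 2)) ^ t * Real.cos ((k + 1 : ℕ) * x)) -
        (k - t / 2) * ((2 * Real.sin (x / 2)) ^ t * Real.cos (k * x))) x := by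
    intro x hx
    have hs := sin_half_pos hx
    have d1 := ((((hasDerivAt_id x).div_const 2).sin).const_mul 2).rpow_const (p := t + 1)
      (Or.inl (by simp only [id]; positivity))
    have d2 := ((hasDerivAt_id x).const_mul ((k : ℝ) + 1 / 2)).cos
    refine (d1.mul d2).congr_deriv ?_
    simp only [id]
    rw [show t + 1 - 1 = t by ring, Real.rpow_add_one (by positivity)]
    push_cast
    rw [show ((k : ℝ) + 1) * x = (k + 1 / 2) * x + x / 2 by ring,
      show (k : ℝ) * x = (k + 1 / 2) * x - x / 2 by ring, Real.cos_add, Real.cos_sub]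
    ring
  have := intervalIntegral.integral_eq_sub_of_hasDerivAt_of_le (by positivity) hFc hFd
    ((h1.const_mul _).sub (h0.const_mul _))
  rw [intervalIntegral.integral_sub (h1.const_mul _) (h0.const_mul _),
    intervalIntegral.integral_const_mul, intervalIntegral.integral_const_mul] at this
  have hb : F (2 * π) - F 0 = 0 := by
    have : t + 1 ≠ 0 := by linarith
    simp [hF, Real.zero_rpow this]
  rw [hb] at this
  unfold cosCoeff
  linarith

theorem cosCoeff_zero_eq {u : ℝ} (hu : |u| < 1 / 2) :
    cosCoeff 0 (-2 * u) = 2 * π * Real.exp (logMean u) := by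
  obtain ⟨h1, h2⟩ := abs_lt.1 hu
  simp only [cosCoeff, Nat.cast_zero, zero_mul, Real.cos_zero, mul_one]
  rw [integral_sin_half_rpow (by linarith), logMean, Real.exp_sub,
    Real.exp_log (Real.Gamma_pos_of_pos (by linarith)), two_mul (Real.log _), Real.exp_add,
    Real.exp_log (Real.Gamma_pos_of_pos (by linarith))]
  ring_nf

theorem exp_logCoeff {k : ℕ} (hk : 1 ≤ k) {u : ℝ} (hu : |u| < 1 / 2) :
    Real.exp (logCoeff k u) = Real.Gamma (1 - 2 * u) * Real.Gamma (k + u) /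
      (Real.Gamma (k - u) * Real.Gamma (1 + u) * Real.Gamma (1 - u) * (k - u)) := by
  obtain ⟨h1, h2⟩ := abs_lt.1 hu
  have hk' : (1 : ℝ) ≤ k := by exact_mod_cast hk
  rw [logCoeff, Real.exp_sub, Real.exp_sub, Real.exp_sub, Real.exp_sub, Real.exp_add,
    Real.exp_log (Real.Gamma_pos_of_pos (by linarith)),
    Real.exp_log (Real.Gamma_pos_of_pos (by linarith)),
    Real.exp_log (Real.Gamma_pos_of_pos (by linarith)),
    Real.exp_log (Real.Gamma_pos_of_pos (by linarith)),
    Real.exp_log (Real.Gamma_pos_of_pos (by linarith)), Real.exp_log (by linarith)]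
  simp only [div_div]

theorem exp_logCoeff_succ {k : ℕ} (hk : 1 ≤ k) {u : ℝ} (hu : |u| < 1 / 2) :
    (k + 1 - u) * Real.exp (logCoeff (k + 1) u) = (k + u) * Real.exp (logCoeff k u) := by
  obtain ⟨h1, h2⟩ := abs_lt.1 hu
  have hk' : (1 : ℝ) ≤ k := by exact_mod_cast hk
  have g1 : 0 < Real.Gamma (k - u) := Real.Gamma_pos_of_pos (by linarith)
  have g2 : 0 < Real.Gamma (1 + u) := Real.Gamma_pos_of_pos (by linarith)
  have g3 : 0 < Real.Gamma (1 - u) := Real.Gamma_pos_of_pos (by linarith)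
  have g4 : 0 < (k : ℝ) - u := by linarith
  have g5 : 0 < (k : ℝ) + 1 - u := by linarith
  rw [exp_logCoeff hk hu, exp_logCoeff (by omega) hu]
  push_cast
  rw [show (k : ℝ) + 1 + u = k + u + 1 by ring,
    Real.Gamma_add_one (by linarith : (k : ℝ) + u ≠ 0),
    show Real.Gamma ((k : ℝ) + 1 - u) = (k - u) * Real.Gamma (k - u) by
      rw [← Real.Gamma_add_one g4.ne']; ring_nf]
  field_simp

theorem cosCoeff_eq {k : ℕ} (hk : 1 ≤ k) {u : ℝ} (hu : |u| < 1 / 2) :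
    cosCoeff k (-2 * u) = 2 * π * (u * Real.exp (logCoeff k u)) := by
  obtain ⟨h1, h2⟩ := abs_lt.1 hu
  induction k, hk using Nat.le_induction with
  | base =>
    -- The recursion at index 0 reads (1 - u) c_1 = u c_0: this is where the factor u enters.
    have hr := cosCoeff_succ 0 (t := -2 * u) (by linarith)
    have g2 : 0 < Real.Gamma (1 + u) := Real.Gamma_pos_of_pos (by linarith)
    have g3 : 0 < Real.Gamma (1 - u) := Real.Gamma_pos_of_pos (by linarith)
    have g4 : 0 < 1 - u := by linarith
    have hm : Real.exp (logMean u) = (1 - u) * Real.exp (logCoeff 1 u) := by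
      rw [exp_logCoeff le_rfl hu, logMean, Real.exp_sub,
        Real.exp_log (Real.Gamma_pos_of_pos (by linarith)), two_mul (Real.log _), Real.exp_add,
        Real.exp_log g3]
      push_cast
      field_simp
    rw [cosCoeff_zero_eq hu, hm] at hr
    push_cast at hr
    rw [show (0 : ℝ) + 1 + -2 * u / 2 = 1 - u by ring] at hr
    apply mul_left_cancel₀ g4.ne'
    rw [hr]
    ring
  | succ k hk ih =>
    have hr := cosCoeff_succ k (t := -2 * u) (by linarith)
    have hs := exp_logCoeff_succ hk hu
    have hk' : (1 : ℝ) ≤ k := by exact_mod_cast hk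
    have g5 : 0 < (k : ℝ) + 1 - u := by linarith
    rw [ih] at hr
    apply mul_left_cancel₀ g5.ne'
    rw [show (k : ℝ) + 1 - u = k + 1 + -2 * u / 2 by ring, hr,
      show (k : ℝ) + 1 + -2 * u / 2 = k + 1 - u by ring]
    linear_combination (-2 * π * u) * hs

/-! ### Differentiation in the exponent through moment generating functions -/

/-- Lebesgue measure on `(0, 2π)` with density `w`. -/
def weightedMeasure (w : ℝ → ℝ) : Measure ℝ :=
  (volume.restrict (Ioo 0 (2 * π))).withDensity fun x => ENNReal.ofReal (w x)

theorem integral_weightedMeasure {w : ℝ → ℝ} (hw : Continuous w) (hw0 : ∀ x, 0 ≤ w x)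
    (F : ℝ → ℝ) :
    ∫ x, F x ∂(weightedMeasure w) = ∫ x in (0 : ℝ)..2 * π, F x * w x := by
  rw [weightedMeasure, integral_withDensity_eq_integral_toReal_smul (by fun_prop)
    (ae_of_all _ fun x => ENNReal.ofReal_lt_top),
    intervalIntegral.integral_of_le Real.two_pi_pos.le, ← restrict_Ioo_eq_restrict_Ioc]
  simp only [ENNReal.toReal_ofReal (hw0 _), smul_eq_mul, mul_comm]

theorem exp_mul_log_sin_half (u : ℝ) {x : ℝ} (hx : x ∈ Ioo 0 (2 * π)) :
    Real.exp (u * (-2 * Real.log |2 * Real.sin (x / 2)|)) =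
      (2 * Real.sin (x / 2)) ^ (-2 * u) := by
  have := sin_half_pos hx
  rw [abs_of_pos (by positivity), Real.rpow_def_of_pos (by positivity)]
  ring_nf

theorem integrable_exp_mul_log_sin_half {u : ℝ} (hu : u < 1 / 2) :
    Integrable (fun x => Real.exp (u * (-2 * Real.log |2 * Real.sin (x / 2)|)))
      (volume.restrict (Ioo 0 (2 * π))) := by
  have := intervalIntegrable_sin_half_rpow (t := -2 * u) (by linarith)
  rw [intervalIntegrable_iff_integrableOn_Ioo_of_le Real.two_pi_pos.le] at this
  exact this.congr_fun (fun x hx => (exp_mul_log_sin_half u hx).symm) measurableSet_Ioo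

/-- For u < 1/2 the exponent -2u exceeds -1, and a bounded density preserves integrability.
Analyticity at 0 and finiteness of all moments follow. -/
theorem zero_mem_interior_integrableExpSet {w : ℝ → ℝ} {C : ℝ} (hwC : ∀ x, w x ≤ C) :
    (0 : ℝ) ∈ interior (integrableExpSet (fun x => -2 * Real.log |2 * Real.sin (x / 2)|)
      (weightedMeasure w)) := by
  refine mem_interior.2 ⟨Iio (1 / 2), fun u hu => ?_, isOpen_Iio, by norm_num⟩
  refine ((integrable_exp_mul_log_sin_half hu).smul_measure
    (ENNReal.ofReal_ne_top (r := C))).mono_measure ?_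
  rw [weightedMeasure, ← withDensity_const]
  exact withDensity_mono (ae_of_all _ fun x => ENNReal.ofReal_le_ofReal (hwC x))

theorem mgf_weightedMeasure {w : ℝ → ℝ} (hw : Continuous w) (hw0 : ∀ x, 0 ≤ w x) :
    mgf (fun x => -2 * Real.log |2 * Real.sin (x / 2)|) (weightedMeasure w) =
      fun u : ℝ => ∫ x in (0 : ℝ)..2 * π, (2 * Real.sin (x / 2)) ^ (-2 * u) * w x := by
  ext u
  rw [mgf, integral_weightedMeasure hw hw0]
  refine intervalIntegral.integral_congr_Ioo_of_le Real.two_pi_pos.le fun x hx => ?_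
  simp only [exp_mul_log_sin_half u hx]

theorem iteratedDeriv_integral_sin_half_rpow {w : ℝ → ℝ} (hw : Continuous w) (hw0 : ∀ x, 0 ≤ w x)
    {C : ℝ} (hwC : ∀ x, w x ≤ C) (n : ℕ) :
    AnalyticAt ℝ
        (fun u : ℝ => ∫ x in (0 : ℝ)..2 * π, (2 * Real.sin (x / 2)) ^ (-2 * u) * w x) 0 ∧
      iteratedDeriv n
        (fun u : ℝ => ∫ x in (0 : ℝ)..2 * π, (2 * Real.sin (x / 2)) ^ (-2 * u) * w x) 0 =
        (-2) ^ n * ∫ x in (0 : ℝ)..2 * π, Real.log |2 * Real.sin (x / 2)| ^ n * w x := by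
  rw [← mgf_weightedMeasure hw hw0]
  have h := zero_mem_interior_integrableExpSet hwC
  refine ⟨analyticAt_mgf h, ?_⟩
  rw [iteratedDeriv_mgf_zero h, ← intervalIntegral.integral_const_mul]
  simp only [Pi.pow_apply]
  rw [integral_weightedMeasure hw hw0]
  simp only [mul_pow, mul_assoc]

theorem intervalIntegrable_log_sin_half_pow_two_pi (n : ℕ) :
    IntervalIntegrable (fun x => Real.log |2 * Real.sin (x / 2)| ^ n) volume 0 (2 * π) := by
  have h := integrable_pow_of_mem_interior_integrableExpSet
    (zero_mem_interior_integrableExpSet (w := fun _ => 1) (C := 1) fun _ => le_rfl) n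
  simp only [weightedMeasure, ENNReal.ofReal_one, withDensity_const, one_smul] at h
  have h2 : IntervalIntegrable (fun x => (-2 * Real.log |2 * Real.sin (x / 2)|) ^ n) volume
      0 (2 * π) := by
    rw [intervalIntegrable_iff_integrableOn_Ioo_of_le Real.two_pi_pos.le]
    exact h
  simp only [mul_pow] at h2
  have := h2.const_mul ((-2 : ℝ) ^ n)⁻¹
  simpa using this

theorem log_sin_half_periodic (n : ℕ) :
    Function.Periodic (fun x => Real.log |2 * Real.sin (x / 2)| ^ n) (2 * π) := by
  intro x
  have : (x + 2 * π) / 2 = x / 2 + π := by ring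
  simp only [this, Real.sin_add_pi, mul_neg, abs_neg]

theorem intervalIntegrable_log_sin_half_pow (n : ℕ) (a b : ℝ) :
    IntervalIntegrable (fun x => Real.log |2 * Real.sin (x / 2)| ^ n) volume a b :=
  (log_sin_half_periodic n).intervalIntegrable₀ Real.two_pi_pos.ne'
    (intervalIntegrable_log_sin_half_pow_two_pi n) a b

theorem iteratedDeriv_cosCoeff (k n : ℕ) :
    iteratedDeriv n (fun u : ℝ => cosCoeff k (-2 * u)) 0 =
      (-2) ^ n * ∫ x in (0 : ℝ)..2 * π, Real.log |2 * Real.sin (x / 2)| ^ n * Real.cos (k * x) := by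
  -- A density must be nonnegative, so cos(kx) is split as (1 + cos(kx)) - 1.
  have hw1 : Continuous fun x : ℝ => 1 + Real.cos (k * x) := by fun_prop
  obtain ⟨a1, h1⟩ := iteratedDeriv_integral_sin_half_rpow hw1
    (fun x => by linarith [Real.neg_one_le_cos (k * x)]) (C := 2)
    (fun x => by linarith [Real.cos_le_one (k * x)]) n
  obtain ⟨a2, h2⟩ := iteratedDeriv_integral_sin_half_rpow (w := fun _ => 1) continuous_const
    (fun _ => zero_le_one) (C := 1) (fun _ => le_rfl) n
  have he : (fun u : ℝ => cosCoeff k (-2 * u)) =ᶠ[𝓝 0]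
      (fun u : ℝ => ∫ x in (0 : ℝ)..2 * π, (2 * Real.sin (x / 2)) ^ (-2 * u) *
        (1 + Real.cos (k * x))) -
      fun u : ℝ => ∫ x in (0 : ℝ)..2 * π, (2 * Real.sin (x / 2)) ^ (-2 * u) * 1 := by
    filter_upwards [Iio_mem_nhds (by norm_num : (0 : ℝ) < 1 / 2)] with u hu
    have hu : u < 1 / 2 := hu
    have i1 := intervalIntegrable_sin_half_rpow (t := -2 * u) (by linarith)
    rw [Pi.sub_apply, ← intervalIntegral.integral_sub (i1.mul_continuousOn (by fun_prop))
      (i1.mul_const 1), cosCoeff]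
    congr 1
    ext x
    ring
  have i1 := intervalIntegrable_log_sin_half_pow n 0 (2 * π)
  rw [he.iteratedDeriv_eq, iteratedDeriv_sub a1.contDiffAt a2.contDiffAt, h1, h2, ← mul_sub,
    ← intervalIntegral.integral_sub (i1.mul_continuousOn (by fun_prop)) (i1.mul_const 1)]
  congr 2
  ext x
  ring

theorem eventually_abs_lt_half : ∀ᶠ u : ℝ in 𝓝 0, |u| < 1 / 2 := by
  have := Metric.ball_mem_nhds (0 : ℝ) (ε := 1 / 2) (by norm_num)
  filter_upwards [this] with u hu
  simpa using hu

theorem integral_log_sin_half_pow (n : ℕ) :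
    (-2) ^ n * ∫ x in (0 : ℝ)..2 * π, Real.log |2 * Real.sin (x / 2)| ^ n =
      2 * π * completeBell (Function.update etaBar 1 0) n := by
  have h := iteratedDeriv_cosCoeff 0 n
  have he : (fun u : ℝ => cosCoeff 0 (-2 * u)) =ᶠ[𝓝 0] fun u => 2 * π * Real.exp (logMean u) := by
    filter_upwards [eventually_abs_lt_half] with u hu using cosCoeff_zero_eq hu
  rw [he.iteratedDeriv_eq, iteratedDeriv_const_mul_field, iteratedDeriv_exp_logMean] at h
  simpa using h.symm

theorem integral_log_sin_half_pow_mul_cos {k : ℕ} (hk : 1 ≤ k) (n : ℕ) :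
    (-2) ^ n * ∫ x in (0 : ℝ)..2 * π, Real.log |2 * Real.sin (x / 2)| ^ n * Real.cos (k * x) =
      2 * π * (n / k * completeBell (xiBar k) (n - 1)) := by
  rw [← iteratedDeriv_cosCoeff]
  have he : (fun u : ℝ => cosCoeff k (-2 * u)) =ᶠ[𝓝 0]
      fun u => 2 * π * (u * Real.exp (logCoeff k u)) := by
    filter_upwards [eventually_abs_lt_half] with u hu using cosCoeff_eq hk hu
  rw [he.iteratedDeriv_eq, iteratedDeriv_const_mul_field]
  cases n with
  | zero => simp
  | succ n => rw [iteratedDeriv_mul_exp_logCoeff hk]; push_cast; rfl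

/-! ### Fourier series of primitives -/

instance fact_two_pi_pos : Fact (0 < 2 * π) := ⟨Real.two_pi_pos⟩

theorem intervalIntegrable_ofReal {f : ℝ → ℝ} {a b : ℝ} (h : IntervalIntegrable f volume a b) :
    IntervalIntegrable (fun x => (f x : ℂ)) volume a b := ⟨h.1.ofReal, h.2.ofReal⟩

theorem fourierCoeff_eq_fourierCoeffOn_two_pi (F : AddCircle (2 * π) → ℂ) (n : ℤ) :
    fourierCoeff F n = fourierCoeffOn Real.two_pi_pos (fun x : ℝ => F x) n := by
  rw [fourierCoeff_eq_intervalIntegral F n 0, fourierCoeffOn_eq_integral]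
  simp

theorem integral_mul_sin_eq_zero {g : ℝ → ℝ} (hsym : ∀ x, g (2 * π - x) = g x) (n : ℤ) :
    ∫ x in (0 : ℝ)..2 * π, g x * Real.sin (n * x) = 0 := by
  have h := intervalIntegral.integral_comp_sub_left (a := 0) (b := 2 * π)
    (fun x => g x * Real.sin (n * x)) (2 * π)
  have h2 : ∀ x, Real.sin (n * (2 * π - x)) = - Real.sin (n * x) := by
    intro x
    rw [mul_sub, Real.sin_int_mul_two_pi_sub]
  simp only [hsym, h2, mul_neg, intervalIntegral.integral_neg, sub_self, sub_zero] at h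
  linarith

theorem fourierCoeffOn_eq_integral_cos {g : ℝ → ℝ} (hsym : ∀ x, g (2 * π - x) = g x)
    (hint : IntervalIntegrable g volume 0 (2 * π)) (n : ℤ) :
    fourierCoeffOn Real.two_pi_pos (fun x => (g x : ℂ)) n =
      (((2 * π)⁻¹ * ∫ x in (0 : ℝ)..2 * π, g x * Real.cos (n * x) : ℝ) : ℂ) := by
  have hc : IntervalIntegrable (fun x => ((g x * Real.cos (n * x) : ℝ) : ℂ)) volume
      0 (2 * π) := intervalIntegrable_ofReal (hint.mul_continuousOn (by fun_prop))
  have hs : IntervalIntegrable (fun x => Complex.I * ((g x * Real.sin (n * x) : ℝ) : ℂ)) volume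
      0 (2 * π) :=
    (intervalIntegrable_ofReal (hint.mul_continuousOn (by fun_prop))).const_mul _
  have he : ∀ x : ℝ, fourier (-n) (x : AddCircle (2 * π - 0)) • (g x : ℂ) =
      ((g x * Real.cos (n * x) : ℝ) : ℂ) - Complex.I * ((g x * Real.sin (n * x) : ℝ) : ℂ) := by
    intro x
    have : (2 * π * Complex.I * ((-n : ℤ) : ℂ) * x / ((2 * π - 0 : ℝ) : ℂ)) =
        ((-(n * x) : ℝ) : ℂ) * Complex.I := by
      have : (π : ℂ) ≠ 0 := by exact_mod_cast Real.pi_ne_zero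
      push_cast
      field_simp
      ring
    rw [fourier_coe_apply, this, Complex.exp_mul_I, ← Complex.ofReal_cos, ← Complex.ofReal_sin,
      Real.cos_neg, Real.sin_neg, smul_eq_mul]
    push_cast
    ring
  rw [fourierCoeffOn_eq_integral]
  simp only [he]
  rw [intervalIntegral.integral_sub hc hs, intervalIntegral.integral_const_mul,
    intervalIntegral.integral_ofReal, intervalIntegral.integral_ofReal,
    integral_mul_sin_eq_zero hsym]
  simp

/-- The primitive of an even `2π`-periodic function of mean zero which is square integrable and
continuous inside a period is the sum of its sine series. -/
theorem hasSum_sin_of_mean_zero {g : ℝ → ℝ} (hper : Function.Periodic g (2 * π))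
    (hsym : ∀ x, g (2 * π - x) = g x) (hint : ∀ a b, IntervalIntegrable g volume a b)
    (hL2 : IntervalIntegrable (fun x => g x ^ 2) volume 0 (2 * π))
    (hcont : ContinuousOn g (Ioo 0 (2 * π))) (hmean : ∫ x in (0 : ℝ)..2 * π, g x = 0) (z : ℝ) :
    HasSum (fun k : ℕ => Real.sin ((k + 1 : ℕ) * z) / ((k + 1 : ℕ) : ℝ) *
      (π⁻¹ * ∫ x in (0 : ℝ)..2 * π, g x * Real.cos ((k + 1 : ℕ) * x))) (∫ x in (0 : ℝ)..z, g x) := by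
  set G : ℝ → ℂ := fun z => ((∫ x in (0 : ℝ)..z, g x : ℝ) : ℂ) with hG
  have hGc : Continuous G :=
    Complex.continuous_ofReal.comp (intervalIntegral.continuous_primitive hint 0)
  have hGp : Function.Periodic G (2 * π) := by
    intro x
    simp only [hG]
    rw [← intervalIntegral.integral_add_adjacent_intervals (hint 0 x) (hint x (x + 2 * π)),
      hper.intervalIntegral_add_eq x 0, zero_add, hmean, add_zero]
  let F : C(AddCircle (2 * π), ℂ) := ⟨hGp.lift, continuous_quot_lift _ hGc⟩
  have hF : ∀ x : ℝ, F x = G x := fun x => hGp.lift_coe x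
  have hG0 : G 0 = 0 := by simp [hG]
  have hGe : G (2 * π) = 0 := by simp [hG, hmean]
  set c : ℤ → ℝ := fun n => (2 * π)⁻¹ * ∫ x in (0 : ℝ)..2 * π, g x * Real.cos (n * x) with hc
  -- Integration by parts; the boundary terms vanish since G(0) = G(2π) = 0, and differentiability
  -- is needed only inside the period, so g may be singular at its ends.
  have hcoef : ∀ n : ℤ, n ≠ 0 → fourierCoeff F n = c n / (Complex.I * n) := by
    intro n hn
    have hn' : (n : ℂ) ≠ 0 := by exact_mod_cast hn
    have hπ : (π : ℂ) ≠ 0 := by exact_mod_cast Real.pi_ne_zero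
    rw [fourierCoeff_eq_fourierCoeffOn_two_pi]
    simp only [hF]
    rw [fourierCoeffOn_of_hasDerivAt_Ioo (f' := fun x => (g x : ℂ)) Real.two_pi_pos hn
      hGc.continuousOn ?_ (intervalIntegrable_ofReal (hint _ _)), hG0, hGe,
      fourierCoeffOn_eq_integral_cos hsym (hint _ _)]
    · simp only [hc]
      push_cast
      field_simp
      simp
    · intro x hx
      rw [min_eq_left Real.two_pi_pos.le, max_eq_right Real.two_pi_pos.le] at hx
      exact (intervalIntegral.integral_hasDerivAt_right (hint 0 x)
        (hcont.stronglyMeasurableAtFilter isOpen_Ioo x hx)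
        (hcont.continuousAt (isOpen_Ioo.mem_nhds hx))).ofReal_comp
  -- Parseval for g. Together with |c_n|/|n| ≤ c_n² + 1/n² it makes the coefficients of F absolutely
  -- summable.
  have hcsq : Summable fun n : ℤ => ‖c n‖ ^ 2 := by
    have hm : MemLp (fun x => (g x : ℂ)) 2 (volume.restrict (Ioc 0 (2 * π))) := by
      refine MemLp.ofReal ((memLp_two_iff_integrable_sq ?_).2 ?_)
      · exact (hint 0 (2 * π)).1.aestronglyMeasurable
      · exact hL2.1
    have := (hasSum_sq_fourierCoeffOn Real.two_pi_pos hm).summable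
    simpa only [fourierCoeffOn_eq_integral_cos hsym (hint _ _), Complex.norm_real] using this
  have hsum : Summable (fourierCoeff F) := by
    refine Summable.of_norm_bounded_eventually
      (hcsq.add (Real.summable_one_div_int_pow (p := 2).2 one_lt_two)) ?_
    filter_upwards [(finite_singleton (0 : ℤ)).compl_mem_cofinite] with n hn
    rw [hcoef n hn, norm_div, norm_mul, Complex.norm_I, one_mul, Complex.norm_real,
      Complex.norm_intCast]
    have h1 : (1 : ℝ) / (n : ℝ) ^ 2 = (1 / |(n : ℝ)|) ^ 2 := by rw [div_pow, sq_abs, one_pow]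
    rw [h1, div_eq_mul_one_div]
    nlinarith [sq_nonneg (‖c n‖ - 1 / |(n : ℝ)|), sq_nonneg (‖c n‖), sq_nonneg (1 / |(n : ℝ)|)]
  have hpt : ∀ z : ℝ, HasSum (fun k : ℕ => fourierCoeff F ((k + 1 : ℕ) : ℤ) •
      fourier ((k + 1 : ℕ) : ℤ) (z : AddCircle (2 * π)) +
      fourierCoeff F (-((k + 1 : ℕ) : ℤ)) • fourier (-((k + 1 : ℕ) : ℤ)) (z : AddCircle (2 * π)))
      (G z - fourierCoeff F 0) := by
    intro z
    have h := (has_pointwise_sum_fourier_series_of_summable hsum (z : AddCircle (2 * π))).nat_add_neg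
    -- Pairing n with -n counts the constant term twice; dropping index 0 leaves G z minus one copy
    -- of it.
    rw [← hasSum_nat_add_iff' 1, hF] at h
    rw [Finset.sum_range_one, Nat.cast_zero, neg_zero, fourier_zero, smul_eq_mul, mul_one,
      add_sub_add_right_eq_sub] at h
    exact h
  have hterm : ∀ (z : ℝ) (k : ℕ), fourierCoeff F ((k + 1 : ℕ) : ℤ) •
      fourier ((k + 1 : ℕ) : ℤ) (z : AddCircle (2 * π)) +
      fourierCoeff F (-((k + 1 : ℕ) : ℤ)) • fourier (-((k + 1 : ℕ) : ℤ)) (z : AddCircle (2 * π)) =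
      ((Real.sin ((k + 1 : ℕ) * z) / ((k + 1 : ℕ) : ℝ) *
      (π⁻¹ * ∫ x in (0 : ℝ)..2 * π, g x * Real.cos ((k + 1 : ℕ) * x)) : ℝ) : ℂ) := by
    intro z k
    have hk : ((k : ℂ) + 1) ≠ 0 := by exact_mod_cast k.succ_ne_zero
    have hπ : (π : ℂ) ≠ 0 := by exact_mod_cast Real.pi_ne_zero
    have e : ∀ m : ℤ, fourier m (z : AddCircle (2 * π)) =
        Complex.cos (m * z) + Complex.sin (m * z) * Complex.I := by
      intro m
      rw [fourier_coe_apply, ← Complex.exp_mul_I]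
      congr 1
      push_cast
      field_simp
    have hneg : c (-((k + 1 : ℕ) : ℤ)) = c ((k + 1 : ℕ) : ℤ) := by
      simp only [hc, Int.cast_neg, neg_mul, Real.cos_neg]
    rw [hcoef _ (by omega), hcoef _ (by omega), e, e, hneg]
    simp only [hc, smul_eq_mul, Int.cast_neg, neg_mul, Complex.cos_neg, Complex.sin_neg,
      Int.cast_natCast]
    push_cast
    field_simp
    ring
  -- At z = 0 every sine and G itself vanish, so the constant term is 0 without integrating G.
  have h0 : fourierCoeff F 0 = 0 := by
    have h := hpt 0
    simp only [hterm, hG0, mul_zero, Real.sin_zero, zero_div, zero_mul, Complex.ofReal_zero,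
      zero_sub] at h
    simpa using h.unique hasSum_zero
  have h := hpt z
  simp only [hterm, h0, sub_zero, hG] at h
  exact_mod_cast h

theorem integral_cos_natCast_mul_eq_zero {k : ℕ} (hk : k ≠ 0) :
    ∫ x in (0 : ℝ)..2 * π, Real.cos (k * x) = 0 := by
  have hk' : (k : ℝ) ≠ 0 := by exact_mod_cast hk
  rw [intervalIntegral.integral_comp_mul_left _ hk', integral_cos]
  have : Real.sin (k * (2 * π)) = 0 := by
    simpa using Real.sin_int_mul_two_pi_sub 0 k
  simp [this]

/-- Subtracting the mean leaves the cosine coefficients with k ≥ 1 unchanged. -/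
theorem hasSum_sin_series {g : ℝ → ℝ} (hper : Function.Periodic g (2 * π))
    (hsym : ∀ x, g (2 * π - x) = g x) (hint : ∀ a b, IntervalIntegrable g volume a b)
    (hL2 : IntervalIntegrable (fun x => g x ^ 2) volume 0 (2 * π))
    (hcont : ContinuousOn g (Ioo 0 (2 * π))) (z : ℝ) :
    HasSum (fun k : ℕ => Real.sin ((k + 1 : ℕ) * z) / ((k + 1 : ℕ) : ℝ) *
      (π⁻¹ * ∫ x in (0 : ℝ)..2 * π, g x * Real.cos ((k + 1 : ℕ) * x)))
      ((∫ x in (0 : ℝ)..z, g x) - z * ((2 * π)⁻¹ * ∫ x in (0 : ℝ)..2 * π, g x)) := by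
  set m : ℝ := (2 * π)⁻¹ * ∫ x in (0 : ℝ)..2 * π, g x with hm
  have hi : ∀ a b, IntervalIntegrable (fun _ : ℝ => m) volume a b := fun a b =>
    intervalIntegrable_const
  have hmean : ∫ x in (0 : ℝ)..2 * π, (g x - m) = 0 := by
    rw [intervalIntegral.integral_sub (hint _ _) (hi _ _), intervalIntegral.integral_const, hm,
      smul_eq_mul, sub_zero, mul_inv_cancel_left₀ Real.two_pi_pos.ne', sub_self]
  have h := hasSum_sin_of_mean_zero (g := fun x => g x - m) (fun x => by simp only [hper x])
    (fun x => by simp only [hsym]) (fun a b => (hint a b).sub (hi a b)) ?_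
    (hcont.sub continuousOn_const) hmean z
  · rw [intervalIntegral.integral_sub (hint _ _) (hi _ _), intervalIntegral.integral_const,
      sub_zero, smul_eq_mul] at h
    convert h using 4 with k
    simp only [sub_mul]
    rw [intervalIntegral.integral_sub ((hint _ _).mul_continuousOn (by fun_prop))
      ((hi _ _).mul_continuousOn (by fun_prop)), intervalIntegral.integral_const_mul,
      integral_cos_natCast_mul_eq_zero k.succ_ne_zero, mul_zero, sub_zero]
  · have : (fun x => (g x - m) ^ 2) = fun x => g x ^ 2 - 2 * m * g x + m ^ 2 := by ext x; ring
    rw [this]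
    exact (hL2.sub ((hint _ _).const_mul _)).add intervalIntegrable_const

/-! ### The sine series for log-sine integrals -/

theorem log_sin_half_two_pi_sub (n : ℕ) (x : ℝ) :
    Real.log |2 * Real.sin ((2 * π - x) / 2)| ^ n = Real.log |2 * Real.sin (x / 2)| ^ n := by
  rw [show (2 * π - x) / 2 = π - x / 2 by ring, Real.sin_pi_sub]

theorem continuousOn_log_sin_half_pow (n : ℕ) :
    ContinuousOn (fun x => Real.log |2 * Real.sin (x / 2)| ^ n) (Ioo 0 (2 * π)) := by
  refine (ContinuousOn.log (by fun_prop) fun x hx => ?_).pow n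
  have := sin_half_pos hx
  positivity

theorem hasSum_integral_log_sin_half_pow (p : ℕ) (z : ℝ) :
    HasSum (fun k : ℕ => 2 * (p : ℝ) * (Real.sin (((k + 1 : ℕ) : ℝ) * z) / ((k + 1 : ℕ) : ℝ) ^ 2
        * completeBell (xiBar (k + 1)) (p - 1)))
      ((-2) ^ p * (∫ x in (0 : ℝ)..z, Real.log |2 * Real.sin (x / 2)| ^ p) -
        z * completeBell (Function.update etaBar 1 0) p) := by
  have h := (hasSum_sin_series (log_sin_half_periodic p) (log_sin_half_two_pi_sub p)
    (intervalIntegrable_log_sin_half_pow p)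
    -- Square integrability of the p-th power is integrability of the 2p-th.
    (by simpa only [← pow_mul] using intervalIntegrable_log_sin_half_pow (p * 2) 0 (2 * π))
    (continuousOn_log_sin_half_pow p) z).mul_left ((-2 : ℝ) ^ p)
  have hπ := Real.pi_pos
  rw [mul_sub, mul_left_comm ((-2 : ℝ) ^ p) z, mul_left_comm ((-2 : ℝ) ^ p) (2 * π)⁻¹,
    integral_log_sin_half_pow, inv_mul_cancel_left₀ Real.two_pi_pos.ne'] at h
  refine h.congr_fun fun k => ?_
  have hk : ((k + 1 : ℕ) : ℝ) ≠ 0 := by exact_mod_cast k.succ_ne_zero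
  have := integral_log_sin_half_pow_mul_cos (k := k + 1) (by omega) p
  rw [mul_left_comm ((-2 : ℝ) ^ p), mul_left_comm ((-2 : ℝ) ^ p), this]
  field_simp

theorem summable_sin_div_sq_mul_completeBell (p : ℕ) (z : ℝ) :
    Summable (fun k : ℕ => Real.sin (((k + 1 : ℕ) : ℝ) * z) / ((k + 1 : ℕ) : ℝ) ^ 2
        * completeBell (xiBar (k + 1)) (p - 1)) := by
  rcases Nat.eq_zero_or_pos p with rfl | hp
  -- For p = 0 the factor p annihilates the series in the previous lemma, which then says nothing;
  -- here p - 1 = 0 and the Bell factor is 1.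
  · have h : Summable fun k : ℕ => 1 / ((k + 1 : ℕ) : ℝ) ^ 2 :=
      (summable_nat_add_iff 1).2 (Real.summable_one_div_nat_pow.2 one_lt_two)
    refine h.of_norm_bounded fun k => ?_
    rw [Nat.zero_sub, completeBell, mul_one, norm_div, norm_pow, Real.norm_natCast,
      Real.norm_eq_abs]
    gcongr
    exact Real.abs_sin_le_one _
  · have hp' : (2 * (p : ℝ)) ≠ 0 := by positivity
    exact (summable_mul_left_iff hp').1 (hasSum_integral_log_sin_half_pow p z).summable

theorem neg_one_pow_succ_div_two_pow_mul (p : ℕ) (I : ℝ) :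
    (-1) ^ (p + 1) / 2 ^ p * ((-2) ^ p * I) = -I := by
  have h : (-1 : ℝ) ^ p * (-1) ^ p = 1 := by rw [← mul_pow]; norm_num
  rw [neg_pow 2, pow_succ]
  field_simp
  linear_combination -I * h

theorem logSine_succ_eq (p : ℕ) (z : ℝ) :
    logSine (p + 1) z =
        (-1) ^ (p + 1) / 2 ^ p *
          (z * completeBell (Function.update etaBar 1 0) p
            + 2 * (p : ℝ) * ∑' k : ℕ, Real.sin (((k + 1 : ℕ) : ℝ) * z) / ((k + 1 : ℕ) : ℝ) ^ 2
                * completeBell (xiBar (k + 1)) (p - 1)) := by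
  have h := (hasSum_integral_log_sin_half_pow p z).tsum_eq
  rw [tsum_mul_left] at h
  rw [h, add_sub_cancel, neg_one_pow_succ_div_two_pow_mul, logSine, Nat.add_sub_cancel]

/-! ### Special values at π and 2π -/

theorem intervalIntegrable_pow_mul_log_sin_half_pow (n p : ℕ) (z : ℝ) :
    IntervalIntegrable (fun x : ℝ => x ^ n * Real.log |2 * Real.sin (x / 2)| ^ p) volume 0 z :=
  (intervalIntegrable_log_sin_half_pow p 0 z).continuousOn_mul (by fun_prop)

theorem integral_log_sin_half_pow_pi (p : ℕ) :
    2 * ∫ x in (0 : ℝ)..π, Real.log |2 * Real.sin (x / 2)| ^ p =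
      ∫ x in (0 : ℝ)..2 * π, Real.log |2 * Real.sin (x / 2)| ^ p := by
  have h := intervalIntegral.integral_comp_sub_left (a := 0) (b := π)
    (fun x => Real.log |2 * Real.sin (x / 2)| ^ p) (2 * π)
  simp only [log_sin_half_two_pi_sub, sub_zero, show 2 * π - π = π by ring] at h
  rw [← intervalIntegral.integral_add_adjacent_intervals
    (intervalIntegrable_log_sin_half_pow p 0 π) (intervalIntegrable_log_sin_half_pow p π (2 * π)), ← h]
  ring

/-- Reflection replaces the weight x by 2π - x, so it may be averaged to π. -/
theorem integral_mul_log_sin_half_pow (p : ℕ) :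
    ∫ x in (0 : ℝ)..2 * π, x * Real.log |2 * Real.sin (x / 2)| ^ p =
      π * ∫ x in (0 : ℝ)..2 * π, Real.log |2 * Real.sin (x / 2)| ^ p := by
  have h := intervalIntegral.integral_comp_sub_left (a := 0) (b := 2 * π)
    (fun x => x * Real.log |2 * Real.sin (x / 2)| ^ p) (2 * π)
  simp only [log_sin_half_two_pi_sub, sub_zero, sub_self, sub_mul] at h
  have hi := intervalIntegrable_pow_mul_log_sin_half_pow 1 p (2 * π)
  simp only [pow_one] at hi
  rw [intervalIntegral.integral_sub ((intervalIntegrable_log_sin_half_pow p _ _).const_mul _) hi,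
    intervalIntegral.integral_const_mul] at h
  linarith

theorem genLogSine_special (p n : ℕ) (z : ℝ)
    (h : (z = 2 * π ∧ (n = 0 ∨ n = 1)) ∨ (z = π ∧ n = 0)) :
    genLogSine (p + n + 1) n z =
      (-1) ^ (p + 1) * z ^ (n + 1) / (2 ^ p * ((n : ℝ) + 1))
        * completeBell (Function.update etaBar 1 0) p := by
  have hπ := Real.pi_pos
  have hI := integral_log_sin_half_pow p
  have hB : completeBell (Function.update etaBar 1 0) p = (2 * π)⁻¹ *
      ((-2) ^ p * ∫ x in (0 : ℝ)..2 * π, Real.log |2 * Real.sin (x / 2)| ^ p) := by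
    rw [hI, inv_mul_cancel_left₀ Real.two_pi_pos.ne']
  have hN : p + n + 1 - n - 1 = p := by omega
  have hmain := neg_one_pow_succ_div_two_pow_mul p
    (∫ x in (0 : ℝ)..2 * π, Real.log |2 * Real.sin (x / 2)| ^ p)
  rw [genLogSine, hN, hB,
    show (-1 : ℝ) ^ (p + 1) * z ^ (n + 1) / (2 ^ p * ((n : ℝ) + 1)) * ((2 * π)⁻¹ *
      ((-2) ^ p * ∫ x in (0 : ℝ)..2 * π, Real.log |2 * Real.sin (x / 2)| ^ p)) =
      z ^ (n + 1) / ((n + 1) * (2 * π)) * ((-1) ^ (p + 1) / 2 ^ p *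
      ((-2) ^ p * ∫ x in (0 : ℝ)..2 * π, Real.log |2 * Real.sin (x / 2)| ^ p)) by
      field_simp, hmain]
  rcases h with ⟨rfl, rfl | rfl⟩ | ⟨rfl, rfl⟩
  · simp only [pow_zero, one_mul, Nat.cast_zero, zero_add, pow_one]
    field_simp
  · simp only [pow_one, integral_mul_log_sin_half_pow, Nat.cast_one]
    field_simp
    ring
  · simp only [pow_zero, one_mul, ← integral_log_sin_half_pow_pi]
    field_simp
    simp

end

theorem mainTheorem7 :
    -- the integrals below exist
    (∀ (n p : ℕ) (z : ℝ), IntervalIntegrable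
      (fun x : ℝ => x ^ n * Real.log |2 * Real.sin (x / 2)| ^ p) MeasureTheory.volume 0 z) ∧
    -- special values of z
    (∀ (p n : ℕ) (z : ℝ), ((z = 2 * π ∧ (n = 0 ∨ n = 1)) ∨ (z = π ∧ n = 0)) →
      genLogSine (p + n + 1) n z =
        (-1) ^ (p + 1) * z ^ (n + 1) / (2 ^ p * ((n : ℝ) + 1))
          * completeBell (Function.update etaBar 1 0) p) ∧
    -- arbitrary z; the series has terms k + 1 = 1, 2, 3, … and the factor p kills it for p = 0
    (∀ (p : ℕ) (z : ℝ),
      Summable (fun k : ℕ => Real.sin (((k + 1 : ℕ) : ℝ) * z) / ((k + 1 : ℕ) : ℝ) ^ 2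
        * completeBell (xiBar (k + 1)) (p - 1)) ∧
      logSine (p + 1) z =
        (-1) ^ (p + 1) / 2 ^ p *
          (z * completeBell (Function.update etaBar 1 0) p
            + 2 * (p : ℝ) * ∑' k : ℕ, Real.sin (((k + 1 : ℕ) : ℝ) * z) / ((k + 1 : ℕ) : ℝ) ^ 2
                * completeBell (xiBar (k + 1)) (p - 1))) ∧
    -- the second form of the coefficients
    (∀ k j : ℕ, 1 ≤ k → 1 ≤ j →
      xiBar k j = etaBar j
        + (if Odd j then 2 * (polygamma (j - 1) (k : ℝ) - polygamma (j - 1) 1) else 0)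
        + ((j - 1)! : ℝ) / (k : ℝ) ^ j) :=
  ⟨intervalIntegrable_pow_mul_log_sin_half_pow, genLogSine_special, fun p z =>
    ⟨summable_sin_div_sq_mul_completeBell p z, logSine_succ_eq p z⟩,
    fun k j _ _ => xiBar_eq_etaBar_add k j⟩
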